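/- Let $H$ be a nonzero separable real or complex Hilbert space, let $T$ be a bounded invertible operator on $H$ (with bounded inverse), and let $\mathcal E_T=\{Tx:\|x\|=1\}$ be its ellipsoidal surface. A finite or countably infinite family $(x_i)_{i\in I}$ in $H$ (repetitions allowed) is a tight frame with frame bound $K>0$ if its linear span is dense and $\sum_{i\in I}|\langle v,x_i\rangle|^2=K\|v\|^2$ for all $v\in H$; its length is the number of indices. Write $|T^*|=(TT^*)^{1/2}$, so that $|T^*|^{-2}=(TT^*)^{-1}$. If $S$ is any positive invertible operator with $\mathcal E_S=\mathcal E_T$, then $(TT^*)^{-1}=S^{-2}$; in particular $(TT^*)^{-1}=T^{-2}$ when $T$ is positive. Moreover: 1. $\mathcal E_T$ contains a tight frame. 2. If $n=\dim H<\infty$, then for every integer $k\ge n$ the surface $\mathcal E_T$ contains a tight frame of length $k$, and every tight frame of length $k$ contained in $\mathcal E_T$ has frame bound $K=k\,[\operatorname{trace}(|T^*|^{-2})]^{-1}$. (This is $k\,[\operatorname{trace}(T^{-2})]^{-1}$ if $T$ is positive.) 3. If $\dim H=\infty$, then for every constant $K>\big(\||T^*|^{-2}\|_{\mathrm{ess}}\big)^{-1}$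 the surface $\mathcal E_T$ contains a tight frame with frame bound $K$, where $\|B\|_{\mathrm{ess}}=\inf\{\|B-C\|: C \text{ a compact operator on } H\}$. (The condition is $K>\|T^{-2}\|_{\mathrm{ess}}^{-1}$ if $T$ is positive.) -/

import Mathlib

section EllipsoidalFrames

variable {𝕜 : Type*} [RCLike 𝕜] {H : Type*} [NormedAddCommGroup H] [InnerProductSpace 𝕜 H]

/-- The family `x` (repetitions allowed) is a frame for `H` with frame bounds `A` and `B`:
it is complete, i.e. its linear span is dense, and
`A ‖v‖² ≤ ∑ |⟨v, x i⟩|² ≤ B ‖v‖²` for all `v`, with `0 < A ≤ B`. -/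
structure IsFrameWith (𝕜 : Type*) [RCLike 𝕜] {H : Type*} [NormedAddCommGroup H]
    [InnerProductSpace 𝕜 H] {ι : Type*} (A B : ℝ) (x : ι → H) : Prop where
  pos : 0 < A
  le : A ≤ B
  complete : Dense (Submodule.span 𝕜 (Set.range x) : Set H)
  summable : ∀ v : H, Summable fun i => ‖inner 𝕜 (x i) v‖ ^ 2
  lower : ∀ v : H, A * ‖v‖ ^ 2 ≤ ∑' i, ‖inner 𝕜 (x i) v‖ ^ 2
  upper : ∀ v : H, ∑' i, ‖inner 𝕜 (x i) v‖ ^ 2 ≤ B * ‖v‖ ^ 2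

/-- A tight frame with frame bound `K`. -/
def IsTightFrame (𝕜 : Type*) [RCLike 𝕜] {H : Type*} [NormedAddCommGroup H]
    [InnerProductSpace 𝕜 H] {ι : Type*} (K : ℝ) (x : ι → H) : Prop :=
  IsFrameWith 𝕜 K K x

/-- The ellipsoidal surface of a bounded invertible operator: the image of the unit sphere. -/
def ellipsoid (T : (H →L[𝕜] H)ˣ) : Set H :=
  (T : H →L[𝕜] H) '' Metric.sphere 0 1

/-- `x` is an ellipsoidal tight frame for the surface of `T`, with frame bound `K`. -/
def IsETF {ι : Type*} (T : (H →L[𝕜] H)ˣ) (K : ℝ) (x : ι → H) : Prop :=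
  (∀ i, x i ∈ ellipsoid T) ∧ IsTightFrame 𝕜 K x

/-- `K` is an attainable frame bound: some finite or countably infinite ellipsoidal tight frame
has frame bound `K`. -/
def IsAttainable (T : (H →L[𝕜] H)ˣ) (K : ℝ) : Prop :=
  ∃ (ι : Type) (_ : Countable ι) (x : ι → H), IsETF T K x

/-- The essential norm: the distance to the compact operators. -/
noncomputable def essNorm (B : H →L[𝕜] H) : ℝ :=
  sInf {r : ℝ | ∃ C : H →L[𝕜] H, IsCompactOperator C ∧ r = ‖B - C‖}

/-- The operator `(T T*)⁻¹ = |T*|⁻²`. For a positive `T` it is `T⁻²`; in general `|T*|` is the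
positive operator that has the same ellipsoidal surface as `T`. -/
noncomputable def invSq [CompleteSpace H] (T : (H →L[𝕜] H)ˣ) : H →L[𝕜] H :=
  ((T * star T)⁻¹ : (H →L[𝕜] H)ˣ)

end EllipsoidalFrames

/-!
Put `R = T⁻¹`, so that `x` lies on the surface iff `‖R x‖ = 1`. It suffices to find a Parseval frame
all of whose vectors satisfy `‖R x‖² = r`: multiplied by `r ^ (-1/2)` it lies on the surface and is
tight with bound `r⁻¹`. Rotating a pair of vectors in its span changes neither `∑ |⟨x i, v⟩|²` nor
`∑ ‖R (x i)‖²`, and by continuity it can give one of the two the value `r` if `r` lies between their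
values. Hence a finite family that, padded by zeros to `k` vectors, has `∑ ‖R (x i)‖² = k r` can be
replaced by `k` vectors with the same frame operator and the constant value `r`.

In dimension `n ≤ k` this applies to an orthonormal basis `b`, with `r = k⁻¹ ∑ ‖R (b i)‖²`.
Conversely, a tight frame has `∑ x i ⊗ x i = K`, and multiplying by `(T T*)⁻¹ = R* R` and taking
traces gives `∑ ‖R (x i)‖²`, the length of the frame, on the left-hand side.

In infinite dimension, let `r = K⁻¹` and `r < c < ‖R* R‖_ess`. Off any finite-dimensional subspace
there are unit vectors with `‖R f‖² ≥ c`, hence there is an orthonormal sequence of them. Distribute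
a completion of it to an orthonormal basis over finite blocks with enough of the `f` in each. Then
carry a fraction of a vector from each block to the preceding one, so that the sum of `‖R ·‖²` over
each block becomes an integer multiple of `r`, and apply the finite result to each block.
-/

section FrameOperator

open InnerProductSpace
open scoped InnerProduct

variable {𝕜 : Type*} [RCLike 𝕜] {H : Type*} [NormedAddCommGroup H] [InnerProductSpace 𝕜 H]
  {E : Type*} [NormedAddCommGroup E] [InnerProductSpace 𝕜 E]

theorem norm_sqrt_smul_sq {E : Type*} [SeminormedAddCommGroup E] [NormedSpace 𝕜 E] {a : ℝ}
    (ha : 0 ≤ a) (y : E) : ‖((√a : ℝ) : 𝕜) • y‖ ^ 2 = a * ‖y‖ ^ 2 := by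
  rw [norm_smul, mul_pow, RCLike.norm_ofReal, sq_abs, Real.sq_sqrt ha]

theorem norm_inner_sqrt_smul_sq {a : ℝ} (ha : 0 ≤ a) (y v : H) :
    ‖⟪((√a : ℝ) : 𝕜) • y, v⟫_𝕜‖ ^ 2 = a * ‖⟪y, v⟫_𝕜‖ ^ 2 := by
  rw [inner_smul_left, RCLike.conj_ofReal, ← smul_eq_mul, norm_sqrt_smul_sq ha]

theorem norm_sq_rotation (a b : E) {c s : ℝ} (h : c ^ 2 + s ^ 2 = 1) :
    ‖(c : 𝕜) • a + (s : 𝕜) • b‖ ^ 2 + ‖(-s : 𝕜) • a + (c : 𝕜) • b‖ ^ 2 = ‖a‖ ^ 2 + ‖b‖ ^ 2 := by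
  rw [norm_add_sq (𝕜 := 𝕜), norm_add_sq (𝕜 := 𝕜)]
  simp only [norm_smul, inner_smul_left, inner_smul_right, norm_neg, RCLike.norm_ofReal, map_neg,
    RCLike.conj_ofReal, mul_pow, sq_abs, neg_mul, RCLike.re_ofReal_mul]
  linear_combination (‖a‖ ^ 2 + ‖b‖ ^ 2) * h

theorem norm_inner_sq_rotation (a b v : H) {c s : ℝ} (h : c ^ 2 + s ^ 2 = 1) :
    ‖⟪(c : 𝕜) • a + (s : 𝕜) • b, v⟫_𝕜‖ ^ 2 + ‖⟪(-s : 𝕜) • a + (c : 𝕜) • b, v⟫_𝕜‖ ^ 2 =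
      ‖⟪a, v⟫_𝕜‖ ^ 2 + ‖⟪b, v⟫_𝕜‖ ^ 2 := by
  simpa [inner_add_left, inner_smul_left] using norm_sq_rotation (𝕜 := 𝕜) ⟪a, v⟫_𝕜 ⟪b, v⟫_𝕜 h

theorem exists_rotation_norm_sq_eq {E : Type*} [SeminormedAddCommGroup E] [NormedSpace 𝕜 E]
    {a b : E} {r : ℝ} (ha : ‖a‖ ^ 2 ≤ r) (hb : r ≤ ‖b‖ ^ 2) :
    ∃ c s : ℝ, c ^ 2 + s ^ 2 = 1 ∧ ‖(c : 𝕜) • a + (s : 𝕜) • b‖ ^ 2 = r := by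
  let φ : ℝ → ℝ := fun θ => ‖((Real.cos θ : ℝ) : 𝕜) • a + ((Real.sin θ : ℝ) : 𝕜) • b‖ ^ 2
  have hφ : Continuous φ := by fun_prop
  have hr : r ∈ Set.Icc (φ 0) (φ (Real.pi / 2)) := ⟨by simpa [φ] using ha, by simpa [φ] using hb⟩
  obtain ⟨θ, -, hθ⟩ := intermediate_value_Icc Real.pi_div_two_pos.le hφ.continuousOn hr
  exact ⟨Real.cos θ, Real.sin θ, Real.cos_sq_add_sin_sq θ, hθ⟩

theorem sum_update_update {κ X M : Type*} [Fintype κ] [DecidableEq κ] [AddCommMonoid M]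
    {y : κ → X} {i j : κ} (hij : i ≠ j) {a b : X} (F : X → M) (h : F a + F b = F (y i) + F (y j)) :
    ∑ l, F (Function.update (Function.update y i a) j b l) = ∑ l, F (y l) := by
  have split_pair (f : κ → M) : ∑ l, f l = f i + f j + ∑ l ∈ {i, j}ᶜ, f l := by
    rw [← Finset.sum_pair hij, Finset.sum_add_sum_compl]
  rw [split_pair, split_pair fun l => F (y l)]
  congr 1
  · simp [hij, h]
  · refine Finset.sum_congr rfl fun l hl => ?_
    simp only [Finset.mem_compl, Finset.mem_insert, Finset.mem_singleton, not_or] at hl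
    rw [Function.update_of_ne hl.2, Function.update_of_ne hl.1]

theorem exists_rotate_pair {κ : Type*} [Fintype κ] (R : H →ₗ[𝕜] E) (y : κ → H) {i j : κ}
    (hij : i ≠ j) {r : ℝ} (hi : ‖R (y i)‖ ^ 2 ≤ r) (hj : r ≤ ‖R (y j)‖ ^ 2) :
    ∃ z : κ → H, ‖R (z i)‖ ^ 2 = r ∧ (∀ l, l ≠ i → l ≠ j → z l = y l) ∧
      ∑ l, ‖R (z l)‖ ^ 2 = ∑ l, ‖R (y l)‖ ^ 2 ∧
      ∀ v, ∑ l, ‖⟪z l, v⟫_𝕜‖ ^ 2 = ∑ l, ‖⟪y l, v⟫_𝕜‖ ^ 2 := by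
  classical
  obtain ⟨c, s, hcs, hr⟩ := exists_rotation_norm_sq_eq (𝕜 := 𝕜) hi hj
  refine ⟨Function.update (Function.update y i ((c : 𝕜) • y i + (s : 𝕜) • y j)) j
    ((-s : 𝕜) • y i + (c : 𝕜) • y j), ?_, fun l hli hlj => by simp [hli, hlj], ?_, fun v => ?_⟩
  · simpa [hij] using hr
  · refine sum_update_update hij (fun w => ‖R w‖ ^ 2) ?_
    simpa only [map_add, map_smul] using norm_sq_rotation (𝕜 := 𝕜) (R (y i)) (R (y j)) hcs
  · exact sum_update_update hij (fun w => ‖⟪w, v⟫_𝕜‖ ^ 2) (norm_inner_sq_rotation _ _ v hcs)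

theorem exists_lt_and_exists_gt_of_sum_eq {κ : Type*} [Fintype κ] {a : κ → ℝ} {r : ℝ}
    (hsum : ∑ i, a i = Fintype.card κ * r) {p : κ} (hp : a p ≠ r) :
    (∃ i, a i < r) ∧ ∃ j, r < a j := by
  have hsum' : ∑ i, a i = ∑ _i : κ, r := by simp [hsum]
  constructor <;> by_contra! h
  · exact hp ((Finset.sum_eq_sum_iff_of_le fun i _ => h i).1 hsum'.symm p (Finset.mem_univ p)).symm
  · exact hp ((Finset.sum_eq_sum_iff_of_le fun i _ => h i).1 hsum' p (Finset.mem_univ p))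

theorem exists_norm_sq_eq_of_sum_eq_card_mul {κ : Type*} [Fintype κ] (R : H →ₗ[𝕜] E) (y : κ → H)
    {r : ℝ} (hy : ∑ i, ‖R (y i)‖ ^ 2 = Fintype.card κ * r) :
    ∃ x : κ → H, (∀ i, ‖R (x i)‖ ^ 2 = r) ∧
      ∀ v, ∑ i, ‖⟪x i, v⟫_𝕜‖ ^ 2 = ∑ i, ‖⟪y i, v⟫_𝕜‖ ^ 2 := by
  classical
  induction hn : (Finset.univ.filter fun i => ‖R (y i)‖ ^ 2 ≠ r).card
    using Nat.strong_induction_on generalizing y with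
  | _ n ih =>
  by_cases hall : ∀ i, ‖R (y i)‖ ^ 2 = r
  · exact ⟨y, hall, fun _ => rfl⟩
  push Not at hall
  obtain ⟨p, hp⟩ := hall
  obtain ⟨⟨i, hi⟩, j, hj⟩ := exists_lt_and_exists_gt_of_sum_eq hy hp
  have hij : i ≠ j := by rintro rfl; exact lt_asymm hi hj
  obtain ⟨z, hzi, hzy, hzsum, hzv⟩ := exists_rotate_pair R y hij hi.le hj.le
  -- The rotation settles the entry `i`, and `j` was not settled before it.
  have hlt : (Finset.univ.filter fun l => ‖R (z l)‖ ^ 2 ≠ r).card < n := by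
    rw [← hn]
    refine Finset.card_lt_card ((Finset.ssubset_iff_of_subset fun l hl => ?_).2 ⟨i, ?_, ?_⟩)
    · simp only [Finset.mem_filter_univ] at hl ⊢
      rcases eq_or_ne l i with rfl | hli
      · exact hi.ne
      rcases eq_or_ne l j with rfl | hlj
      · exact hj.ne'
      · rwa [hzy l hli hlj] at hl
    · simpa using hi.ne
    · simpa using hzi
  obtain ⟨x, hx, hxv⟩ := ih _ hlt z (hzsum.trans hy) rfl
  exact ⟨x, hx, fun v => (hxv v).trans (hzv v)⟩

theorem exists_fin_norm_sq_eq {κ : Type*} [Fintype κ] (R : H →ₗ[𝕜] E) (y : κ → H) {k : ℕ}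
    (hk : Fintype.card κ ≤ k) {r : ℝ} (hy : ∑ i, ‖R (y i)‖ ^ 2 = k * r) :
    ∃ x : Fin k → H, (∀ i, ‖R (x i)‖ ^ 2 = r) ∧
      ∀ v, ∑ i, ‖⟪x i, v⟫_𝕜‖ ^ 2 = ∑ i, ‖⟪y i, v⟫_𝕜‖ ^ 2 := by
  let padded : κ ⊕ Fin (k - Fintype.card κ) → H := Sum.elim y 0
  have hcard : Fintype.card (κ ⊕ Fin (k - Fintype.card κ)) = k := by simp [hk]
  obtain ⟨x, hx, hxv⟩ := exists_norm_sq_eq_of_sum_eq_card_mul R padded (r := r)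
    (by simp [hcard, padded, hy])
  let e := (Fintype.equivFinOfCardEq hcard).symm
  refine ⟨x ∘ e, fun i => hx _, fun v => ?_⟩
  calc ∑ i, ‖⟪x (e i), v⟫_𝕜‖ ^ 2 = ∑ i, ‖⟪x i, v⟫_𝕜‖ ^ 2 :=
        Equiv.sum_comp e fun i => ‖⟪x i, v⟫_𝕜‖ ^ 2
    _ = ∑ i, ‖⟪y i, v⟫_𝕜‖ ^ 2 := by simp [hxv, padded]

variable (𝕜) in
/-- `x` is a Parseval frame: the tight frame identity with constant `1`. Every tight frame is a
multiple of such a family. -/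
def IsParseval {ι : Type*} (x : ι → H) : Prop :=
  ∀ v : H, HasSum (fun i => ‖⟪x i, v⟫_𝕜‖ ^ 2) (‖v‖ ^ 2)

theorem isTightFrame_of_hasSum [CompleteSpace H] {ι : Type*} {K : ℝ} (hK : 0 < K) {x : ι → H}
    (h : ∀ v, HasSum (fun i => ‖⟪x i, v⟫_𝕜‖ ^ 2) (K * ‖v‖ ^ 2)) : IsTightFrame 𝕜 K x where
  pos := hK
  le := le_rfl
  complete := by
    rw [Submodule.dense_iff_topologicalClosure_eq_top, Submodule.topologicalClosure_eq_top_iff,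
      Submodule.eq_bot_iff]
    intro v hv
    have horth : ∀ i, ‖⟪x i, v⟫_𝕜‖ ^ 2 = 0 := fun i => by
      rw [hv _ (Submodule.subset_span ⟨i, rfl⟩)]; simp
    have hzero : K * ‖v‖ ^ 2 = 0 := (h v).unique (by simp only [horth]; exact hasSum_zero)
    simpa [hK.ne'] using hzero
  summable v := (h v).summable
  lower v := (h v).tsum_eq.ge
  upper v := (h v).tsum_eq.le

theorem IsParseval.isTightFrame_sqrt_smul [CompleteSpace H] {ι : Type*} {x : ι → H}
    (hx : IsParseval 𝕜 x) {K : ℝ} (hK : 0 < K) :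
    IsTightFrame 𝕜 K fun i => ((√K : ℝ) : 𝕜) • x i :=
  isTightFrame_of_hasSum hK fun v => by
    simpa only [norm_inner_sqrt_smul_sq hK.le] using (hx v).mul_left K

theorem IsTightFrame.sum_norm_inner_sq {ι : Type*} [Fintype ι] {K : ℝ} {x : ι → H}
    (h : IsTightFrame 𝕜 K x) (v : H) : ∑ i, ‖⟪x i, v⟫_𝕜‖ ^ 2 = K * ‖v‖ ^ 2 := by
  rw [← tsum_fintype (L := .unconditional _)]
  exact le_antisymm (h.upper v) (h.lower v)

theorem eq_of_isSymmetric_of_inner_map_self_eq {A B : H →L[𝕜] H}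
    (hA : (A : H →ₗ[𝕜] H).IsSymmetric) (hB : (B : H →ₗ[𝕜] H).IsSymmetric)
    (h : ∀ v, ⟪A v, v⟫_𝕜 = ⟪B v, v⟫_𝕜) : A = B := by
  have hzero := (hA.sub hB).inner_map_self_eq_zero.1 fun v => by
    simpa [inner_sub_left, sub_eq_zero] using h v
  ext v
  simpa [sub_eq_zero] using DFunLike.congr_fun hzero v

theorem IsTightFrame.sum_rankOne {ι : Type*} [Fintype ι] {K : ℝ} {x : ι → H}
    (h : IsTightFrame 𝕜 K x) : ∑ i, rankOne 𝕜 (x i) (x i) = (K : 𝕜) • .id 𝕜 H := by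
  refine eq_of_isSymmetric_of_inner_map_self_eq (fun v w => ?_) (fun v w => ?_) fun v => ?_
  · simp [sum_inner, inner_sum, inner_smul_left, inner_smul_right, mul_comm]
  · simp [inner_smul_left, inner_smul_right]
  · calc ⟪(∑ i, rankOne 𝕜 (x i) (x i)) v, v⟫_𝕜 = ∑ i, (‖⟪x i, v⟫_𝕜‖ : 𝕜) ^ 2 := by
          simp only [sum_apply, rankOne_apply, sum_inner, inner_smul_left, RCLike.conj_mul]
      _ = (K : 𝕜) * (‖v‖ : 𝕜) ^ 2 := mod_cast congrArg (RCLike.ofReal (K := 𝕜))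
          (h.sum_norm_inner_sq v)
      _ = ⟪((K : 𝕜) • ContinuousLinearMap.id 𝕜 H) v, v⟫_𝕜 := by
          simp [inner_smul_left]

theorem IsTightFrame.mul_trace [FiniteDimensional 𝕜 H] {ι : Type*} [Fintype ι] {K : ℝ} {x : ι → H}
    (h : IsTightFrame 𝕜 K x) (A : H →L[𝕜] H) :
    (K : 𝕜) * LinearMap.trace 𝕜 H A = ∑ i, ⟪x i, A (x i)⟫_𝕜 := by
  calc (K : 𝕜) * LinearMap.trace 𝕜 H A
      = LinearMap.trace 𝕜 H (A ∘L ((K : 𝕜) • .id 𝕜 H) : H →L[𝕜] H) := by simp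
    _ = ∑ i, LinearMap.trace 𝕜 H (rankOne 𝕜 (A (x i)) (x i)) := by
      rw [← h.sum_rankOne]
      simp [ContinuousLinearMap.comp_finsetSum, comp_rankOne]
    _ = ∑ i, ⟪x i, A (x i)⟫_𝕜 := by simp only [trace_rankOne]

end FrameOperator

section Ellipsoid

open scoped InnerProduct

variable {𝕜 : Type*} [RCLike 𝕜] {H : Type*} [NormedAddCommGroup H] [InnerProductSpace 𝕜 H]
  {S T : (H →L[𝕜] H)ˣ}

theorem mem_ellipsoid_iff {x : H} : x ∈ ellipsoid T ↔ ‖(↑T⁻¹ : H →L[𝕜] H) x‖ = 1 := by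
  constructor
  · rintro ⟨y, hy, rfl⟩
    have hinv : (↑T⁻¹ : H →L[𝕜] H) ((T : H →L[𝕜] H) y) = y := DFunLike.congr_fun T.inv_mul y
    simpa [hinv] using hy
  · exact fun h => ⟨_, by simpa using h, DFunLike.congr_fun T.mul_inv x⟩

theorem norm_inv_apply_eq_of_ellipsoid_eq (h : ellipsoid S = ellipsoid T) (x : H) :
    ‖(↑T⁻¹ : H →L[𝕜] H) x‖ = ‖(↑S⁻¹ : H →L[𝕜] H) x‖ := by
  rcases eq_or_ne x 0 with rfl | hx
  · simp
  have hS : ‖(↑S⁻¹ : H →L[𝕜] H) x‖ ≠ 0 :=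
    norm_ne_zero_iff.2 ((ContinuousLinearEquiv.ofUnit S⁻¹).map_ne_zero_iff.2 hx)
  have hmem : ((‖(↑S⁻¹ : H →L[𝕜] H) x‖⁻¹ : ℝ) : 𝕜) • x ∈ ellipsoid S :=
    mem_ellipsoid_iff.2 (by simp [norm_smul, hS])
  rw [h, mem_ellipsoid_iff, map_smul, norm_smul, RCLike.norm_ofReal, abs_inv, abs_norm] at hmem
  exact ((inv_mul_eq_one₀ hS).1 hmem).symm

variable [CompleteSpace H]

theorem adjoint_comp_self_eq_of_norm_eq {E : Type*} [NormedAddCommGroup E] [InnerProductSpace 𝕜 E]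
    [CompleteSpace E] {A B : H →L[𝕜] E} (h : ∀ v, ‖A v‖ = ‖B v‖) : A† ∘L A = B† ∘L B := by
  have hsymm (C : H →L[𝕜] E) : ((C† ∘L C : H →L[𝕜] H) : H →ₗ[𝕜] H).IsSymmetric := fun v w => by
    simp [ContinuousLinearMap.adjoint_inner_left, ContinuousLinearMap.adjoint_inner_right]
  refine eq_of_isSymmetric_of_inner_map_self_eq (hsymm A) (hsymm B) fun v => ?_
  simp [ContinuousLinearMap.adjoint_inner_left, h]

theorem invSq_eq_adjoint_comp_self (T : (H →L[𝕜] H)ˣ) :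
    invSq T = (↑T⁻¹ : H →L[𝕜] H)† ∘L (↑T⁻¹ : H →L[𝕜] H) := by
  rw [invSq, mul_inv_rev, Units.val_mul, ← star_inv]
  rfl

theorem invSq_eq_of_ellipsoid_eq (h : ellipsoid S = ellipsoid T) : invSq T = invSq S := by
  rw [invSq_eq_adjoint_comp_self, invSq_eq_adjoint_comp_self,
    adjoint_comp_self_eq_of_norm_eq (norm_inv_apply_eq_of_ellipsoid_eq h)]

theorem invSq_eq_inv_sq_of_isSelfAdjoint (hS : IsSelfAdjoint (S : H →L[𝕜] H)) :
    invSq S = (↑S⁻¹ : H →L[𝕜] H) ^ 2 := by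
  have hstar : star S = S := Units.ext hS
  rw [invSq, hstar, mul_inv_rev, Units.val_mul, sq]

theorem IsParseval.isETF_sqrt_smul {ι : Type*} {x : ι → H} (hx : IsParseval 𝕜 x) {K : ℝ}
    (hK : 0 < K) (hT : ∀ i, ‖(↑T⁻¹ : H →L[𝕜] H) (x i)‖ ^ 2 = K⁻¹) :
    IsETF T K fun i => ((√K : ℝ) : 𝕜) • x i := by
  refine ⟨fun i => mem_ellipsoid_iff.2 ?_, hx.isTightFrame_sqrt_smul hK⟩
  rw [← pow_eq_one_iff_of_nonneg (norm_nonneg _) two_ne_zero, map_smul, norm_sqrt_smul_sq hK.le,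
    hT, mul_inv_cancel₀ hK.ne']

end Ellipsoid

section FiniteDimensional

variable {𝕜 : Type*} [RCLike 𝕜] {H : Type*} [NormedAddCommGroup H] [InnerProductSpace 𝕜 H]
  [FiniteDimensional 𝕜 H]

theorem exists_isETF_fin [Nontrivial H] (T : (H →L[𝕜] H)ˣ) {k : ℕ}
    (hk : Module.finrank 𝕜 H ≤ k) : ∃ (K : ℝ) (x : Fin k → H), IsETF T K x := by
  have : CompleteSpace H := FiniteDimensional.complete 𝕜 H
  let R : H →L[𝕜] H := ↑T⁻¹
  let b := stdOrthonormalBasis 𝕜 H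
  have hR : ∀ i, R (b i) ≠ 0 := fun i =>
    (ContinuousLinearEquiv.ofUnit T⁻¹).map_ne_zero_iff.2 (b.orthonormal.ne_zero i)
  have hsum : 0 < ∑ i, ‖R (b i)‖ ^ 2 :=
    have : Nonempty (Fin (Module.finrank 𝕜 H)) := b.toBasis.index_nonempty
    Finset.sum_pos (fun i _ => by have := hR i; positivity) Finset.univ_nonempty
  have hk₀ : (0 : ℝ) < k := mod_cast Module.finrank_pos.trans_le hk
  obtain ⟨x, hx, hxb⟩ := exists_fin_norm_sq_eq (R : H →ₗ[𝕜] H) b (by simpa using hk)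
    (r := (∑ i, ‖R (b i)‖ ^ 2) / k) (by simp [mul_div_cancel₀ _ hk₀.ne'])
  have hParseval : IsParseval 𝕜 x := fun v => by
    rw [← b.sum_sq_norm_inner_right v, ← hxb v]
    exact hasSum_fintype _
  exact ⟨k / ∑ i, ‖R (b i)‖ ^ 2, _,
    hParseval.isETF_sqrt_smul (div_pos hk₀ hsum) fun i => by rw [inv_div]; exact hx i⟩

variable [CompleteSpace H]

theorem IsETF.mul_trace_invSq {ι : Type*} [Fintype ι] {T : (H →L[𝕜] H)ˣ} {K : ℝ} {x : ι → H}
    (h : IsETF T K x) :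
    (K : 𝕜) * LinearMap.trace 𝕜 H (invSq T : H →ₗ[𝕜] H) = Fintype.card ι := by
  have hx : ∀ i, ‖(↑T⁻¹ : H →L[𝕜] H) (x i)‖ = 1 := fun i => mem_ellipsoid_iff.1 (h.1 i)
  rw [h.2.mul_trace, invSq_eq_adjoint_comp_self]
  simp [ContinuousLinearMap.adjoint_inner_right, hx]

theorem trace_invSq_ne_zero [Nontrivial H] (T : (H →L[𝕜] H)ˣ) :
    LinearMap.trace 𝕜 H (invSq T : H →ₗ[𝕜] H) ≠ 0 := by
  obtain ⟨K, x, hx⟩ := exists_isETF_fin T le_rfl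
  refine right_ne_zero_of_mul (a := (K : 𝕜)) ?_
  rw [hx.mul_trace_invSq, Fintype.card_fin]
  exact_mod_cast Module.finrank_pos.ne'

theorem IsETF.eq_card_mul_inv_trace [Nontrivial H] {ι : Type*} [Fintype ι] {T : (H →L[𝕜] H)ˣ}
    {K : ℝ} {x : ι → H} (h : IsETF T K x) :
    (K : 𝕜) = Fintype.card ι * (LinearMap.trace 𝕜 H (invSq T : H →ₗ[𝕜] H))⁻¹ := by
  rw [← h.mul_trace_invSq, mul_inv_cancel_right₀ (trace_invSq_ne_zero T)]

end FiniteDimensional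

section Blocks

open scoped InnerProductSpace

variable {𝕜 : Type*} [RCLike 𝕜] {H : Type*} [NormedAddCommGroup H] [InnerProductSpace 𝕜 H]
  {E : Type*} [NormedAddCommGroup E] [InnerProductSpace 𝕜 E]

theorem isParseval_hilbertBasis {ι : Type*} (b : HilbertBasis ι 𝕜 H) : IsParseval 𝕜 b := fun v => by
  simpa [b.repr_apply_apply] using lp.hasSum_norm (by norm_num) (b.repr v)

theorem countable_of_orthonormal [TopologicalSpace.SeparableSpace H] {ι : Type*} {b : ι → H}
    (hb : Orthonormal 𝕜 b) : Countable ι := by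
  have hdist : ∀ i j, i ≠ j → ‖b i - b j‖ ^ 2 = 2 := fun i j hij => by
    rw [norm_sub_sq (𝕜 := 𝕜), hb.1, hb.1, hb.2 hij]
    norm_num
  refine Pairwise.countable_of_isOpen_disjoint (s := fun i => Metric.ball (b i) (1 / 2))
    (fun i j hij => Metric.ball_disjoint_ball ?_) (fun _ => Metric.isOpen_ball)
    (fun i => ⟨b i, Metric.mem_ball_self (by norm_num)⟩)
  rw [dist_eq_norm]
  nlinarith [hdist i j hij, norm_nonneg (b i - b j)]

theorem exists_isParseval_sumElim [CompleteSpace H] [TopologicalSpace.SeparableSpace H] {f : ℕ → H}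
    (hf : Orthonormal 𝕜 f) : ∃ e : ℕ → H, IsParseval 𝕜 (Sum.elim f e) := by
  obtain ⟨w, b, hw, hb⟩ := hf.toSubtypeRange.exists_hilbertBasis_extension
  have : Countable w := countable_of_orthonormal (hb ▸ b.orthonormal)
  let g : ℕ → w := fun n => ⟨f n, hw ⟨n, rfl⟩⟩
  have hg : Function.Injective g := fun m n h =>
    hf.linearIndependent.injective (congrArg Subtype.val h)
  obtain ⟨enc, henc⟩ := exists_injective_nat ((Set.range g)ᶜ : Set w)
  refine ⟨Function.extend enc (fun i => (i : H)) 0, fun v => ?_⟩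
  have hsum : HasSum (fun i : w => ‖⟪(i : H), v⟫_𝕜‖ ^ 2) (‖v‖ ^ 2) := by
    simpa only [hb] using isParseval_hilbertBasis b v
  rw [← hsum.tsum_eq, ← hsum.summable.tsum_subtype_add_tsum_subtype_compl (Set.range g)]
  refine HasSum.sum ?_ ?_
  · exact (hg.hasSum_range_iff (f := fun i : w => ‖⟪(i : H), v⟫_𝕜‖ ^ 2)).1
      (hsum.summable.subtype _).hasSum
  · refine ((hasSum_extend_zero henc).2 (hsum.summable.subtype (Set.range g)ᶜ).hasSum).congr_fun
      fun n => ?_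
    by_cases hn : ∃ i, enc i = n
    · obtain ⟨i, rfl⟩ := hn
      simp [henc.extend_apply]
    · simp [Function.extend_apply' _ _ _ hn]

theorem exists_blocks [CompleteSpace H] [TopologicalSpace.SeparableSpace H] (κ : Type*) [Fintype κ]
    [Nonempty κ] {f : ℕ → H} (hf : Orthonormal 𝕜 f) :
    ∃ u : ℕ → κ ⊕ Unit → H, (∀ n i, u n (.inl i) ∈ Set.range f) ∧
      ∀ v, HasSum (fun n => ∑ i, ‖⟪u n i, v⟫_𝕜‖ ^ 2) (‖v‖ ^ 2) := by
  obtain ⟨e, he⟩ := exists_isParseval_sumElim hf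
  obtain ⟨σ⟩ := nonempty_equiv_of_countable (α := ℕ × κ) (β := ℕ)
  let τ : ℕ × (κ ⊕ Unit) ≃ ℕ ⊕ ℕ :=
    (Equiv.prodSumDistrib ℕ κ Unit).trans (Equiv.sumCongr σ (Equiv.prodPUnit ℕ))
  exact ⟨fun n i => Sum.elim f e (τ (n, i)), fun n i => ⟨σ (n, i), rfl⟩, fun v =>
    (τ.hasSum_iff.2 (he v)).prod_fiberwise fun n => hasSum_fintype _⟩

theorem hasSum_sub_add_shift {G : Type*} [AddCommGroup G] [TopologicalSpace G]
    [IsTopologicalAddGroup G] {q w : ℕ → G} {a : G} (hq : HasSum q a) (hw : Summable w)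
    (hw₀ : w 0 = 0) : HasSum (fun n => q n - w n + w (n + 1)) a := by
  have hshift : HasSum (fun n => w (n + 1)) (∑' n, w n) := by
    simpa [hw₀] using (hasSum_nat_add_iff' 1).2 hw.hasSum
  simpa using (hq.sub hw.hasSum).add hshift

theorem exists_carry_step {r q Q : ℝ} (hr : 0 < r) (hq : r ≤ q) {m : ℕ} (hQ : m * r ≤ Q) :
    ∃ t ∈ Set.Icc (0 : ℝ) 1, ∃ k : ℕ, m + 1 ≤ k ∧ Q + t * q = k * r := by
  have hq₀ : 0 < q := hr.trans_le hq
  have hm : m ≤ ⌊Q / r⌋₊ := Nat.le_floor ((le_div_iff₀ hr).2 hQ)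
  have hlower : ⌊Q / r⌋₊ * r ≤ Q :=
    (le_div_iff₀ hr).1 (Nat.floor_le (div_nonneg (le_trans (by positivity) hQ) hr.le))
  have hupper : Q < (⌊Q / r⌋₊ + 1) * r := (div_lt_iff₀ hr).1 (Nat.lt_floor_add_one _)
  refine ⟨((⌊Q / r⌋₊ + 1) * r - Q) / q, ⟨by have := hupper.le; bound, ?_⟩, ⌊Q / r⌋₊ + 1,
    Nat.succ_le_succ hm, ?_⟩
  · rw [div_le_one hq₀]
    linarith
  · rw [div_mul_cancel₀ _ hq₀.ne']
    push_cast
    ring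

theorem exists_carry_weights {r : ℝ} (hr : 0 < r) {q Q : ℕ → ℝ} {m : ℕ} (hq : ∀ n, r ≤ q n)
    (hQ : ∀ n, m * r + q n ≤ Q n) :
    ∃ (t : ℕ → ℝ) (k : ℕ → ℕ), t 0 = 0 ∧ (∀ n, t n ∈ Set.Icc (0 : ℝ) 1) ∧
      ∀ n, m + 1 ≤ k n ∧ Q n - t n * q n + t (n + 1) * q (n + 1) = k n * r := by
  have hstep : ∀ n (s : Set.Icc (0 : ℝ) 1), ∃ (t : Set.Icc (0 : ℝ) 1) (k : ℕ),
      m + 1 ≤ k ∧ Q n - s * q n + t * q (n + 1) = k * r := by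
    rintro n ⟨s, -, hs⟩
    have hsq : s * q n ≤ q n := mul_le_of_le_one_left (hr.le.trans (hq n)) hs
    obtain ⟨t, ht, k, hk⟩ := exists_carry_step hr (hq (n + 1)) (Q := Q n - s * q n) (m := m)
      (by linarith [hQ n])
    exact ⟨⟨t, ht⟩, k, hk⟩
  choose next k hk using hstep
  let t : ℕ → Set.Icc (0 : ℝ) 1 := fun n => Nat.rec ⟨0, by simp⟩ next n
  exact ⟨fun n => (t n).1, fun n => k n (t n), rfl, fun n => (t n).2, fun n => hk n (t n)⟩

/-- The block `u` after a transfer of squared weight: the share `s` of its vector `u i₀` leaves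
the block, and the share `t` of a vector `w` from outside enters it as the new entry `none`. -/
noncomputable def transferBlock (𝕜 : Type*) [RCLike 𝕜] {H : Type*} [NormedAddCommGroup H]
    [InnerProductSpace 𝕜 H] {κ : Type*} [DecidableEq κ] (u : κ → H) (i₀ : κ) (w : H) (s t : ℝ) :
    Option κ → H
  | none => ((√t : ℝ) : 𝕜) • w
  | some i => Function.update u i₀ (((√(1 - s) : ℝ) : 𝕜) • u i₀) i

theorem sum_transferBlock {κ : Type*} [Fintype κ] [DecidableEq κ] (u : κ → H) (i₀ : κ) (w : H)
    {s t : ℝ} (hs : s ≤ 1) (ht : 0 ≤ t) {φ : H → ℝ}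
    (hφ : ∀ a : ℝ, 0 ≤ a → ∀ y, φ (((√a : ℝ) : 𝕜) • y) = a * φ y) :
    ∑ i, φ (transferBlock 𝕜 u i₀ w s t i) = ∑ i, φ (u i) - s * φ (u i₀) + t * φ w := by
  have hupdate : ∑ i, φ (Function.update u i₀ (((√(1 - s) : ℝ) : 𝕜) • u i₀) i) =
      (1 - s) * φ (u i₀) + ∑ i ∈ Finset.univ.erase i₀, φ (u i) := by
    rw [← Finset.add_sum_erase _ _ (Finset.mem_univ i₀), Function.update_self,
      hφ _ (sub_nonneg.2 hs)]
    refine congrArg _ (Finset.sum_congr rfl fun i hi => ?_)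
    rw [Function.update_of_ne (Finset.ne_of_mem_erase hi)]
  rw [Fintype.sum_option, ← Finset.add_sum_erase _ (fun i => φ (u i)) (Finset.mem_univ i₀)]
  simp only [transferBlock]
  rw [hφ t ht, hupdate]
  ring

theorem isParseval_sigma {ι : Type*} {κ : ι → Type*} [∀ n, Fintype (κ n)] {x : ∀ n, κ n → H}
    (h : ∀ v, HasSum (fun n => ∑ i, ‖⟪x n i, v⟫_𝕜‖ ^ 2) (‖v‖ ^ 2)) :
    IsParseval 𝕜 fun p : Σ n, κ n => x p.1 p.2 := fun v => by
  refine HasSum.sigma_of_hasSum (h v) (fun n => hasSum_fintype _) ?_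
  refine (summable_sigma_of_nonneg fun p => by positivity).2
    ⟨fun n => (hasSum_fintype _).summable, ?_⟩
  simpa only [tsum_fintype] using (h v).summable

theorem exists_isParseval_norm_sq_eq_of_blocks {κ : Type*} [Fintype κ] (R : H →ₗ[𝕜] E)
    {u : ℕ → κ → H} (hu : ∀ v, HasSum (fun n => ∑ i, ‖⟪u n i, v⟫_𝕜‖ ^ 2) (‖v‖ ^ 2))
    {r : ℝ} (hr : 0 < r) (i₀ : κ) (hi₀ : ∀ n, r ≤ ‖R (u n i₀)‖ ^ 2)
    (hsum : ∀ n, Fintype.card κ * r + ‖R (u n i₀)‖ ^ 2 ≤ ∑ i, ‖R (u n i)‖ ^ 2) :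
    ∃ (ι : Type) (_ : Countable ι) (x : ι → H), (∀ i, ‖R (x i)‖ ^ 2 = r) ∧ IsParseval 𝕜 x := by
  classical
  obtain ⟨t, k, ht₀, ht, hk⟩ := exists_carry_weights hr hi₀ hsum
  let y : ℕ → Option κ → H := fun n => transferBlock 𝕜 (u n) i₀ (u (n + 1) i₀) (t n) (t (n + 1))
  have hyR : ∀ n, ∑ i, ‖R (y n i)‖ ^ 2 = k n * r := fun n => by
    rw [← (hk n).2]
    exact sum_transferBlock _ _ _ (ht n).2 (ht (n + 1)).1 (φ := fun z => ‖R z‖ ^ 2)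
      fun a ha z => by rw [map_smul, norm_sqrt_smul_sq ha]
  have hyv : ∀ v n, ∑ i, ‖⟪y n i, v⟫_𝕜‖ ^ 2 = ∑ i, ‖⟪u n i, v⟫_𝕜‖ ^ 2
      - t n * ‖⟪u n i₀, v⟫_𝕜‖ ^ 2 + t (n + 1) * ‖⟪u (n + 1) i₀, v⟫_𝕜‖ ^ 2 := fun v n =>
    sum_transferBlock _ _ _ (ht n).2 (ht (n + 1)).1 (φ := fun z => ‖⟪z, v⟫_𝕜‖ ^ 2)
      fun a ha z => norm_inner_sqrt_smul_sq ha z v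
  have hblock : ∀ n, ∃ x : Fin (k n) → H, (∀ i, ‖R (x i)‖ ^ 2 = r) ∧
      ∀ v, ∑ i, ‖⟪x i, v⟫_𝕜‖ ^ 2 = ∑ i, ‖⟪y n i, v⟫_𝕜‖ ^ 2 := fun n =>
    exists_fin_norm_sq_eq R (y n) (by simpa using (hk n).1) (hyR n)
  choose x hx hxy using hblock
  refine ⟨Σ n, Fin (k n), inferInstance, fun p => x p.1 p.2, fun p => hx _ _,
    isParseval_sigma fun v => ?_⟩
  simp only [hxy, hyv]
  refine hasSum_sub_add_shift (w := fun n => t n * ‖⟪u n i₀, v⟫_𝕜‖ ^ 2) (hu v) ?_ (by simp [ht₀])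
  refine (hu v).summable.of_nonneg_of_le (fun n => mul_nonneg (ht n).1 (sq_nonneg _)) fun n => ?_
  calc t n * ‖⟪u n i₀, v⟫_𝕜‖ ^ 2 ≤ ‖⟪u n i₀, v⟫_𝕜‖ ^ 2 :=
        mul_le_of_le_one_left (sq_nonneg _) (ht n).2
    _ ≤ ∑ i, ‖⟪u n i, v⟫_𝕜‖ ^ 2 := Finset.single_le_sum
        (f := fun i => ‖⟪u n i, v⟫_𝕜‖ ^ 2) (fun i _ => sq_nonneg _) (Finset.mem_univ i₀)

theorem exists_isParseval_norm_sq_eq [CompleteSpace H] [TopologicalSpace.SeparableSpace H]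
    (R : H →ₗ[𝕜] E) {f : ℕ → H} (hf : Orthonormal 𝕜 f) {r c : ℝ} (hr : 0 < r) (hrc : r < c)
    (hfR : ∀ n, c ≤ ‖R (f n)‖ ^ 2) :
    ∃ (ι : Type) (_ : Countable ι) (x : ι → H), (∀ i, ‖R (x i)‖ ^ 2 = r) ∧ IsParseval 𝕜 x := by
  -- `l` is chosen so that `l` vectors with `‖R f‖² ≥ c` pay for all `l + 2` vectors of a block.
  obtain ⟨l, hl⟩ := exists_nat_ge (2 * r / (c - r))
  rw [div_le_iff₀ (sub_pos.2 hrc)] at hl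
  obtain ⟨u, huf, hu⟩ := exists_blocks (Fin (l + 1)) hf
  have hc : ∀ n i, c ≤ ‖R (u n (.inl i))‖ ^ 2 := fun n i => by
    obtain ⟨m, hm⟩ := huf n i
    exact hm ▸ hfR m
  refine exists_isParseval_norm_sq_eq_of_blocks R hu hr (.inl 0) (fun n => hrc.le.trans (hc n 0))
    fun n => ?_
  have htail : l * c ≤ ∑ i : Fin l, ‖R (u n (.inl i.succ))‖ ^ 2 := by
    simpa using Finset.sum_le_sum (s := Finset.univ) fun (i : Fin l) _ => hc n i.succ
  have hcard : Fintype.card (Fin (l + 1) ⊕ Unit) * r ≤ l * c := by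
    simp only [Fintype.card_sum, Fintype.card_fin, Fintype.card_unit]
    push_cast
    linarith
  rw [Fintype.sum_sum_type, Fin.sum_univ_succ]
  linarith [Finset.sum_nonneg (s := Finset.univ)
    fun (i : Unit) _ => sq_nonneg ‖R (u n (.inr i))‖]

end Blocks

section EssentialNorm

open scoped InnerProduct InnerProductSpace

variable {𝕜 : Type*} [RCLike 𝕜] {H : Type*} [NormedAddCommGroup H] [InnerProductSpace 𝕜 H]

theorem essNorm_le_norm_sub {B C : H →L[𝕜] H} (hC : IsCompactOperator C) :
    essNorm B ≤ ‖B - C‖ :=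
  csInf_le ⟨0, by rintro _ ⟨_, -, rfl⟩; exact norm_nonneg _⟩ ⟨C, hC, rfl⟩

theorem isCompactOperator_starProjection (F : Submodule 𝕜 H) [FiniteDimensional 𝕜 F] :
    IsCompactOperator F.starProjection := by
  have hid : IsCompactOperator (id : F → F) :=
    (isCompactOperator_id_iff_finiteDimensional (𝕜 := 𝕜)).2 inferInstance
  exact (hid.comp_clm F.orthogonalProjectionOnto).clm_comp F.subtypeL

variable [CompleteSpace H]

theorem essNorm_pos (hH : ¬ FiniteDimensional 𝕜 H) (B : (H →L[𝕜] H)ˣ) :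
    0 < essNorm (B : H →L[𝕜] H) := by
  have : Nontrivial H := by
    by_contra h
    rw [not_nontrivial_iff_subsingleton] at h
    exact hH inferInstance
  have hpos : 0 < ‖(↑B⁻¹ : H →L[𝕜] H)‖⁻¹ := inv_pos.2 (Units.norm_pos _)
  refine hpos.trans_le (le_csInf ⟨_, 0, isCompactOperator_zero, rfl⟩ ?_)
  rintro _ ⟨C, hC, rfl⟩
  by_contra! hlt
  -- Operators this close to `B` are invertible, while a compact operator is not.
  let U := B.ofNearby C (by rwa [norm_sub_rev] at hlt)
  have hid : (↑U⁻¹ : H →L[𝕜] H) ∘ C = id := funext fun z => DFunLike.congr_fun U.inv_mul z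
  exact hH ((isCompactOperator_id_iff_finiteDimensional (𝕜 := 𝕜)).1 (hid ▸ hC.clm_comp _))

variable {E : Type*} [NormedAddCommGroup E] [InnerProductSpace 𝕜 E] [CompleteSpace E]

theorem essNorm_adjoint_comp_self_le (R : H →L[𝕜] E) (F : Submodule 𝕜 H) [FiniteDimensional 𝕜 F] :
    essNorm (R† ∘L R) ≤ ‖R ∘L Fᗮ.starProjection‖ ^ 2 := by
  set A := R† ∘L R
  set Q := F.starProjection
  set P := Fᗮ.starProjection
  have hPQ : P = 1 - Q := F.starProjection_orthogonal
  have hcompact : IsCompactOperator (A ∘L Q + Q ∘L A ∘L P : H →L[𝕜] H) :=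
    ((isCompactOperator_starProjection F).clm_comp A).add
      ((isCompactOperator_starProjection F).comp_clm (A ∘L P))
  have hcompression : A - (A ∘L Q + Q ∘L A ∘L P) = (R ∘L P)† ∘L (R ∘L P) := by
    have hadj : P† = P := isSelfAdjoint_starProjection Fᗮ
    rw [ContinuousLinearMap.adjoint_comp, hadj]
    change A - (A * Q + Q * (A * P)) = P * (A * P)
    rw [hPQ]
    noncomm_ring
  calc essNorm A ≤ ‖A - (A ∘L Q + Q ∘L A ∘L P)‖ := essNorm_le_norm_sub hcompact
    _ = ‖R ∘L P‖ ^ 2 := by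
      rw [hcompression, ContinuousLinearMap.norm_adjoint_comp_self, sq]

theorem exists_unit_orthogonal_of_lt_essNorm (R : H →L[𝕜] E) {c : ℝ} (hc₀ : 0 ≤ c)
    (hc : c < essNorm (R† ∘L R)) (F : Submodule 𝕜 H) [FiniteDimensional 𝕜 F] :
    ∃ y ∈ Fᗮ, ‖y‖ = 1 ∧ c ≤ ‖R y‖ ^ 2 := by
  set P := Fᗮ.starProjection
  have hopNorm : √c < ‖R ∘L P‖ :=
    (Real.sqrt_lt_sqrt hc₀ (hc.trans_le (essNorm_adjoint_comp_self_le R F))).trans_eq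
      (Real.sqrt_sq (norm_nonneg _))
  obtain ⟨v, hv, hcv⟩ : ∃ v, ‖v‖ < 1 ∧ √c < ‖R (P v)‖ :=
    (R ∘L P).exists_lt_apply_of_lt_opNorm hopNorm
  have hPv : ‖P v‖ ≤ 1 := (Fᗮ.norm_starProjection_apply_le v).trans hv.le
  have hPv₀ : P v ≠ 0 := fun h₀ => by
    rw [h₀, map_zero, norm_zero] at hcv
    exact (Real.sqrt_nonneg c).not_gt hcv
  refine ⟨((‖P v‖⁻¹ : ℝ) : 𝕜) • P v, Fᗮ.smul_mem _ (Fᗮ.starProjection_apply_mem v),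
    by simp [norm_smul, hPv₀], (Real.sqrt_le_left (norm_nonneg _)).1 ?_⟩
  calc √c ≤ ‖R (P v)‖ := hcv.le
    _ ≤ ‖P v‖⁻¹ * ‖R (P v)‖ := le_mul_of_one_le_left (norm_nonneg _)
        ((one_le_inv₀ (norm_pos_iff.2 hPv₀)).2 hPv)
    _ = ‖R (((‖P v‖⁻¹ : ℝ) : 𝕜) • P v)‖ := by
        rw [map_smul, norm_smul, RCLike.norm_ofReal, abs_inv, abs_norm]

theorem exists_orthonormal_seq_of_lt_essNorm (R : H →L[𝕜] E) {c : ℝ} (hc₀ : 0 ≤ c)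
    (hc : c < essNorm (R† ∘L R)) : ∃ f : ℕ → H, Orthonormal 𝕜 f ∧ ∀ n, c ≤ ‖R (f n)‖ ^ 2 := by
  have : Std.Symm fun x y : H => ⟪x, y⟫_𝕜 = 0 := ⟨fun _ _ => inner_eq_zero_symm.1⟩
  obtain ⟨f, hf, horth⟩ := exists_seq_of_forall_finset_exists'
    (fun y : H => ‖y‖ = 1 ∧ c ≤ ‖R y‖ ^ 2) (fun x y => ⟪x, y⟫_𝕜 = 0) fun s _ => by
      have : FiniteDimensional 𝕜 (Submodule.span 𝕜 (s : Set H)) := FiniteDimensional.span_finset 𝕜 s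
      obtain ⟨y, hy, hy₁, hyc⟩ := exists_unit_orthogonal_of_lt_essNorm R hc₀ hc
        (Submodule.span 𝕜 s)
      exact ⟨y, ⟨hy₁, hyc⟩, fun x hx => hy x (Submodule.subset_span hx)⟩
  exact ⟨f, ⟨fun n => (hf n).1, horth⟩, fun n => (hf n).2⟩

theorem isAttainable_of_inv_essNorm_lt [TopologicalSpace.SeparableSpace H]
    (hH : ¬ FiniteDimensional 𝕜 H) (T : (H →L[𝕜] H)ˣ) {K : ℝ} (hK : (essNorm (invSq T))⁻¹ < K) :
    IsAttainable T K := by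
  have hess : 0 < essNorm (invSq T) := essNorm_pos hH _
  have hK₀ : 0 < K := (inv_pos.2 hess).trans hK
  obtain ⟨c, hKc, hc⟩ := exists_between (inv_lt_of_inv_lt₀ hess hK)
  rw [invSq_eq_adjoint_comp_self] at hc
  obtain ⟨f, hf, hfc⟩ := exists_orthonormal_seq_of_lt_essNorm _ ((inv_pos.2 hK₀).trans hKc).le hc
  obtain ⟨ι, hι, x, hx, hParseval⟩ :=
    exists_isParseval_norm_sq_eq (↑T⁻¹ : H →L[𝕜] H).toLinearMap hf (inv_pos.2 hK₀) hKc hfc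
  exact ⟨ι, hι, _, hParseval.isETF_sqrt_smul hK₀ hx⟩

end EssentialNorm

theorem theorem3_general {𝕜 : Type*} [RCLike 𝕜] {H : Type*} [NormedAddCommGroup H]
    [InnerProductSpace 𝕜 H] [CompleteSpace H] [TopologicalSpace.SeparableSpace H] [Nontrivial H]
    (T : (H →L[𝕜] H)ˣ) :
    (∃ K : ℝ, IsAttainable T K) ∧
    (∀ S : (H →L[𝕜] H)ˣ, IsSelfAdjoint (S : H →L[𝕜] H) → ellipsoid S = ellipsoid T →
      invSq T = ((S⁻¹ : (H →L[𝕜] H)ˣ) : H →L[𝕜] H) ^ 2) ∧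
    (FiniteDimensional 𝕜 H → ∀ k : ℕ, Module.finrank 𝕜 H ≤ k →
      (∃ (K : ℝ) (x : Fin k → H), IsETF T K x) ∧
      ∀ (K : ℝ) (x : Fin k → H), IsETF T K x →
        (K : 𝕜) = (k : 𝕜) * (LinearMap.trace 𝕜 H (invSq T : H →ₗ[𝕜] H))⁻¹) ∧
    (¬ FiniteDimensional 𝕜 H → ∀ K : ℝ, (essNorm (invSq T))⁻¹ < K → IsAttainable T K) := by
  refine ⟨?_, fun S hS hST => ?_, fun _ k hk => ⟨exists_isETF_fin T hk, fun K x hx => ?_⟩,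
    fun hH K hK => isAttainable_of_inv_essNorm_lt hH T hK⟩
  · by_cases hH : FiniteDimensional 𝕜 H
    · obtain ⟨K, x, hx⟩ := exists_isETF_fin T le_rfl
      exact ⟨K, _, inferInstance, x, hx⟩
    · exact ⟨_, isAttainable_of_inv_essNorm_lt hH T (lt_add_one _)⟩
  · rw [invSq_eq_of_ellipsoid_eq hST, invSq_eq_inv_sq_of_isSelfAdjoint hS]
  · simpa only [Fintype.card_fin] using hx.eq_card_mul_inv_trace

theorem theorem3 {𝕜 : Type*} [RCLike 𝕜] {H : Type*} [NormedAddCommGroup H]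
    [InnerProductSpace 𝕜 H] [CompleteSpace H] [TopologicalSpace.SeparableSpace H] [Nontrivial H]
    (T : (H →L[𝕜] H)ˣ) :
    -- the surface contains a tight frame
    (∃ K : ℝ, IsAttainable T K) ∧
    -- `invSq T` is `S⁻²` for any positive `S` with the same surface, in particular for `S = T`
    -- when `T` is positive
    (∀ S : (H →L[𝕜] H)ˣ, (S : H →L[𝕜] H).IsPositive → ellipsoid S = ellipsoid T →
      invSq T = ((S⁻¹ : (H →L[𝕜] H)ˣ) : H →L[𝕜] H) ^ 2) ∧
    -- finite dimension
    (FiniteDimensional 𝕜 H → ∀ k : ℕ, Module.finrank 𝕜 H ≤ k →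
      (∃ (K : ℝ) (x : Fin k → H), IsETF T K x) ∧
      ∀ (K : ℝ) (x : Fin k → H), IsETF T K x →
        (K : 𝕜) = (k : 𝕜) * (LinearMap.trace 𝕜 H (invSq T : H →ₗ[𝕜] H))⁻¹) ∧
    -- infinite dimension
    (¬ FiniteDimensional 𝕜 H → ∀ K : ℝ, (essNorm (invSq T))⁻¹ < K → IsAttainable T K) := by
  obtain ⟨hbound, hsq, hfin, hinf⟩ := theorem3_general T
  exact ⟨hbound, fun S hS => hsq S hS.isSelfAdjoint, hfin, hinf⟩
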